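/- **Lower bound for LCS on run-length encoded strings without prefix-sum oracles.** *Strings.* Let $\Sigma$ be a finite alphabet with $|\Sigma|\ge 2$. A run-length encoded (RLE) string $S$ of encoded length $|S|=n$ over $\Sigma$ is a sequence $S[1]\cdots S[n]$ of runs, the run $S[i]$ having a character $C(S[i])\in\Sigma$ and a length $R(S[i])\ge 1$, where $C(S[i])\ne C(S[i+1])$ for all $i<n$. Its decoded string $\tilde S$ is $C(S[1])^{R(S[1])}\cdots C(S[n])^{R(S[n])}$. A longest common substring (LCS) of two strings is a contiguous substring of both that has the maximum length among all common contiguous substrings. *The problem* $\mathsf{LCS\text{-}RLE}$. Given oracle access to RLE strings $A$ and $B$, output a triple $(i_A,i_B,\ell)$ such that there is an RLE string $s$ with $|s|=\ell$ whose decoded string $\tilde s$ is an LCS of $\tilde A$ and $\tilde B$, an instance of $\tilde s$ in $\tilde A$ starts within the run $A[i_A]$, and an instance of $\tilde s$ in $\tilde B$ starts within the run $B[i_B]$. *The model.* The input strings are accessed only through the unitaries $$O_S:\ |i\rangle|c\rangle|r\rangle\mapsto|i\rangle|c\oplus C(S[i])\rangle|r\oplus R(S[i])\rangle,\qquad S\in\{A,B\},$$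 where characters and run lengths are written in binary and $\oplus$ is the bitwise exclusive or; in particular no oracle for the prefix sums $\sum_{j\le i}R(S[j])$ is given. A $T$-query quantum algorithm starts in a fixed basis state of the query registers, a one-qubit selector that says which of $A$, $B$ is queried, and a workspace of arbitrary finite dimension; it applies $U_T\,O\,U_{T-1}\,O\cdots O\,U_0$, where the $U_t$ are arbitrary unitaries independent of the input and $O$ is the selected oracle; it then measures in the computational basis and computes its output from the result. *Claim.* Any quantum oracle algorithm needs $\tilde\Omega(n)$ queries to solve $\mathsf{LCS\text{-}RLE}$ with probability at least $2/3$, and more precisely $\Omega(n/\log^2 n)$ queries: there are absolute constants $c>0$ and $n_0$ such that for all $n\ge n_0$, all $N\ge 8n$ and every $\Sigma$ with $2\le|\Sigma|<\infty$, every $T$-query quantum algorithm that, for every pair of RLE strings $A,B$ over $\Sigma$ of encoded length exactly $n$ and decoded length at most $N$, outputs a correct triple with probability at least $2/3$ satisfies $$T\ \ge\ \frac{c\,n}{\log^2 n}.$$ -/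

import Mathlib

/-- A run-length encoded string with `n` runs over the alphabet `Fin q`: a sequence of
(character, length) pairs, all lengths positive and neighbouring runs with different characters
(so that every run is maximal). Its encoded length is `n`. -/
structure RLEString (q n : ℕ) where
  run : Fin n → Fin q × ℕ
  run_pos : ∀ i, 0 < (run i).2
  run_maximal : ∀ i j : Fin n, i.val + 1 = j.val → (run i).1 ≠ (run j).1

namespace RLEString

/-- The decoded string. -/
def decode {q n : ℕ} (S : RLEString q n) : List (Fin q) :=
  (List.ofFn S.run).flatMap fun p => List.replicate p.2 p.1

/-- The sum of the lengths of the first `i` runs. -/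
def prefixSum {q n : ℕ} (S : RLEString q n) (i : ℕ) : ℕ :=
  ∑ j : Fin n with j.val < i, (S.run j).2

/-- An instance of the string `t` in the decoded string starts within the `i`-th run
(runs are counted from 1). -/
def InstanceStartsInRun {q n : ℕ} (S : RLEString q n) (t : List (Fin q)) (i : ℕ) : Prop :=
  1 ≤ i ∧ i ≤ n ∧ ∃ x y : List (Fin q), S.decode = x ++ t ++ y ∧
    S.prefixSum (i - 1) ≤ x.length ∧ x.length < S.prefixSum i

end RLEString

/-- `t` is a longest common (contiguous) substring of `a` and `b`. -/
def IsLongestCommonSubstring {α : Type*} (t a b : List α) : Prop :=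
  t <:+: a ∧ t <:+: b ∧ ∀ u : List α, u <:+: a → u <:+: b → u.length ≤ t.length

/-- The triple `(i_A, i_B, ℓ)` is a correct answer to the LCS problem on the RLE strings `A`, `B`:
some longest common substring of the decoded strings has an RLE with `ℓ` runs, an instance
starting within the run `A[i_A]` and an instance starting within the run `B[i_B]`. -/
def IsLCSRLEAnswer {q m n : ℕ} (A : RLEString q m) (B : RLEString q n) (out : ℕ × ℕ × ℕ) : Prop :=
  ∃ s : RLEString q out.2.2,
    IsLongestCommonSubstring s.decode A.decode B.decode ∧
    A.InstanceStartsInRun s.decode out.1 ∧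
    B.InstanceStartsInRun s.decode out.2.1

/-- Labels of the computational basis: a bit selecting which of the two strings is queried, an index
register, a character register and a run-length register (bit strings just long enough for all
characters of `Fin q` and all numbers up to `N`), and a workspace of dimension `w`. -/
abbrev BasisLabel (q n N w : ℕ) : Type :=
  Bool × Fin n × BitVec (Nat.clog 2 q) × BitVec (Nat.size N) × Fin w

instance instFintypeBitVec (k : ℕ) : Fintype (BitVec k) :=
  Fintype.ofEquiv (Fin (2 ^ k))
    ⟨BitVec.ofFin, BitVec.toFin, fun _ => rfl, fun _ => rfl⟩

/-- The action of the string oracles on basis states: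
`|s⟩|i⟩|c⟩|r⟩|z⟩ ↦ |s⟩|i⟩|c ⊕ C(S[i])⟩|r ⊕ R(S[i])⟩|z⟩`, where `S` is `A` if the selector bit `s` is
`false` and `B` if it is `true`, and `⊕` is the bitwise exclusive or. -/
def oracleMap {q n : ℕ} (N w : ℕ) (A B : RLEString q n) :
    BasisLabel q n N w → BasisLabel q n N w
  | (s, i, c, r, z) =>
    (s, i, c ^^^ BitVec.ofNat (Nat.clog 2 q) ((cond s B A).run i).1.val,
      r ^^^ BitVec.ofNat (Nat.size N) ((cond s B A).run i).2, z)

theorem oracleMap_involutive {q n : ℕ} (N w : ℕ) (A B : RLEString q n) :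
    Function.Involutive (oracleMap N w A B) := by
  rintro ⟨s, i, c, r, z⟩
  have h : ∀ (k : ℕ) (a b : BitVec k), a ^^^ b ^^^ b = a := by
    intro k a b
    rw [BitVec.xor_assoc, BitVec.xor_self, BitVec.xor_zero]
  exact Prod.ext rfl (Prod.ext rfl (Prod.ext (h _ _ _) (Prod.ext (h _ _ _) rfl)))

/-- The oracle as a permutation of the computational basis. -/
def oraclePerm {q n : ℕ} (N w : ℕ) (A B : RLEString q n) : Equiv.Perm (BasisLabel q n N w) :=
  (oracleMap_involutive N w A B).toPerm

/-- A quantum oracle algorithm with `T` queries: an initial basis state, `T + 1` arbitrary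
input-independent unitaries `U₀, …, U_T`, between which the oracle is applied, and a final
measurement in the computational basis whose result is mapped to a triple of numbers. -/
structure QuantumQueryAlgorithm (q n N w T : ℕ) where
  init : BasisLabel q n N w
  unitary : Fin (T + 1) → Matrix.unitaryGroup (BasisLabel q n N w) ℂ
  output : BasisLabel q n N w → ℕ × ℕ × ℕ

namespace QuantumQueryAlgorithm

/-- The state `U_t O U_{t-1} O ⋯ O U₀ |init⟩` after `t ≤ T` queries (for `t > T` it is left
unchanged). -/
noncomputable def stateAfter {q n N w T : ℕ} (𝒜 : QuantumQueryAlgorithm q n N w T)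
    (A B : RLEString q n) : ℕ → BasisLabel q n N w → ℂ
  | 0 => Matrix.mulVec (𝒜.unitary 0).val (Pi.single 𝒜.init 1)
  | t + 1 =>
    if h : t + 1 < T + 1 then
      Matrix.mulVec (𝒜.unitary ⟨t + 1, h⟩).val
        (fun x => 𝒜.stateAfter A B t ((oraclePerm N w A B).symm x))
    else 𝒜.stateAfter A B t

open Classical in
/-- The probability that the output of the algorithm with oracle access to `A` and `B` is a correct
answer to the LCS problem on `A` and `B`. -/
noncomputable def successProb {q n N w T : ℕ} (𝒜 : QuantumQueryAlgorithm q n N w T)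
    (A B : RLEString q n) : ℝ :=
  ∑ x : BasisLabel q n N w with IsLCSRLEAnswer A B (𝒜.output x), ‖𝒜.stateAfter A B T x‖ ^ 2

/-- The algorithm solves the LCS problem with probability at least `2/3` on all pairs of RLE strings
of encoded length `n` and decoded length at most `N`. -/
def SolvesLCSRLE {q n N w T : ℕ} (𝒜 : QuantumQueryAlgorithm q n N w T) : Prop :=
  ∀ A B : RLEString q n, A.decode.length ≤ N → B.decode.length ≤ N → 2 / 3 ≤ 𝒜.successProb A B

end QuantumQueryAlgorithm

/-! The number of runs `ℓ` in the answer already reveals a global count. Let `P` be a payload whose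
run lengths, 1 or 2, encode a set `x ⊆ range (2 * h + 1)`, six runs per element, so that `|P| = p +
6 * |x|`. Put `A = u P 0^k` and `B = 0^k P v` with short paddings `u`, `v` and `k = p + 6 * h + 5`.
Both `P` and `0^k` are common substrings. If `|x| = h`, the zeros win and every LCS is unary, so `ℓ
= 1` (`IsLCSRLEAnswer.runs_eq_one`). If `|x| = h + 1`, the payload is longer than every run of `A`,
so `ℓ ≠ 1` (`IsLCSRLEAnswer.runs_ne_one`). Solving LCS thus separates weight `h` from weight `h +
1`.

Each run length depends on at most one bit, so the adversary method applies. In the graph joining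
`x` to `insert j x`, every vertex has degree `h + 1` and each index `j` lies on at most one edge at
a vertex. The summed overlap of the states along the edges must drop by a constant fraction, while
one query lowers it by at most 2 per pair of vertices (`succ_le_of_query_algorithm`). This gives a
bound linear in `h`, hence in `n`, which is stronger than the claim. -/

/-! ### The adversary bound for adjacent Hamming weights. -/

section QueryLowerBound

variable {ι : Type*} [Fintype ι]

/-- The real part of the inner product of two state vectors. -/
noncomputable def overlap (ψ φ : ι → ℂ) : ℝ := ∑ b, (star (ψ b) * φ b).re

/-- The squared norm of the part of a state vector on the basis states labelled `j` by `β`. -/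
noncomputable def queryWeight (β : ι → ℕ) (j : ℕ) (ψ : ι → ℂ) : ℝ :=
  ∑ b with β b = j, ‖ψ b‖ ^ 2

theorem star_mul_self_re (a : ℂ) : (star a * a).re = ‖a‖ ^ 2 := by
  rw [Complex.sq_norm, Complex.normSq_apply]
  simp

theorem overlap_self (ψ : ι → ℂ) : overlap ψ ψ = ∑ b, ‖ψ b‖ ^ 2 :=
  Finset.sum_congr rfl fun b _ => star_mul_self_re (ψ b)

theorem abs_star_mul_re_le (a b : ℂ) :
    |(star a * b).re| ≤ (‖a‖ ^ 2 + ‖b‖ ^ 2) / 2 := by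
  have h := Complex.abs_re_le_norm (star a * b)
  rw [norm_mul, norm_star] at h
  nlinarith [sq_nonneg (‖a‖ - ‖b‖)]

/-- AM-GM with weight 3/4, a rational stand-in for `1/√2`; this avoids square roots when bounding
overlaps of states told apart with error 1/3. -/
theorem star_mul_re_le_weighted (a b : ℂ) :
    (star a * b).re ≤ (3 / 4 * ‖a‖ ^ 2 + 4 / 3 * ‖b‖ ^ 2) / 2 := by
  have h := Complex.re_le_norm (star a * b)
  rw [norm_mul, norm_star] at h
  nlinarith [sq_nonneg (3 * ‖a‖ - 4 * ‖b‖)]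

theorem overlap_mulVec [DecidableEq ι] (U : Matrix.unitaryGroup ι ℂ) (ψ φ : ι → ℂ) :
    overlap (Matrix.mulVec U.val ψ) (Matrix.mulVec U.val φ) = overlap ψ φ := by
  have key : ∀ a b : ι → ℂ, overlap a b = (star a ⬝ᵥ b).re := by
    intro a b
    simp [overlap, dotProduct]
  have hU : (U.val).conjTranspose * U.val = 1 := Matrix.mem_unitaryGroup_iff'.1 U.2
  rw [key, key, Matrix.star_mulVec, Matrix.dotProduct_mulVec, Matrix.vecMul_vecMul, hU,
    Matrix.vecMul_one]

theorem overlap_comp_perm (π : Equiv.Perm ι) (ψ φ : ι → ℂ) :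
    overlap (fun b => ψ (π b)) (fun b => φ (π b)) = overlap ψ φ :=
  Equiv.sum_comp π fun b => (star (ψ b) * φ b).re

theorem sum_filter_comp_perm {β : ι → ℕ} (j : ℕ) {π : Equiv.Perm ι} (hπ : ∀ b, β (π b) = β b)
    (f : ι → ℝ) : ∑ b with β b = j, f (π b) = ∑ b with β b = j, f b := by
  rw [Finset.sum_filter, Finset.sum_filter]
  refine Eq.trans (Finset.sum_congr rfl fun b _ => ?_)
    (Equiv.sum_comp π fun b => if β b = j then f b else 0)
  rw [hπ]

theorem sum_queryWeight_le (β : ι → ℕ) (s : Finset ℕ) (ψ : ι → ℂ) :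
    ∑ j ∈ s, queryWeight β j ψ ≤ ∑ b, ‖ψ b‖ ^ 2 := by
  simp only [queryWeight, Finset.sum_filter]
  rw [Finset.sum_comm]
  refine Finset.sum_le_sum fun b _ => ?_
  rw [Finset.sum_ite_eq]
  split_ifs
  · exact le_rfl
  · exact sq_nonneg _

/-- One query to two oracles that differ only at the label `j` changes the overlap by at most the
total weight that the two states have at `j`. -/
theorem overlap_le_overlap_query_add {β : ι → ℕ} (j : ℕ) {π ρ : Equiv.Perm ι}
    (hπ : ∀ b, β (π b) = β b) (hρ : ∀ b, β (ρ b) = β b) (h : ∀ b, β b ≠ j → π b = ρ b)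
    (ψ φ : ι → ℂ) :
    overlap ψ φ ≤ overlap (fun b => ψ (π b)) (fun b => φ (ρ b)) +
      (queryWeight β j ψ + queryWeight β j φ) := by
  have e1 : overlap ψ φ = overlap (fun b => ψ (π b)) (fun b => φ (π b)) :=
    (overlap_comp_perm π ψ φ).symm
  have e2 : overlap (fun b => ψ (π b)) (fun b => φ (π b)) -
      overlap (fun b => ψ (π b)) (fun b => φ (ρ b)) =
      ∑ b with β b = j, ((star (ψ (π b)) * φ (π b)).re - (star (ψ (π b)) * φ (ρ b)).re) := by
    rw [overlap, overlap, ← Finset.sum_sub_distrib, Finset.sum_filter]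
    refine Finset.sum_congr rfl fun b _ => ?_
    split_ifs with hb
    · rfl
    · rw [h b hb, sub_self]
  -- Both permutations preserve the label, so after this bound each sum over the fibre of `j` can be
  -- reindexed back to a query weight.
  have e3 : ∑ b with β b = j, ((star (ψ (π b)) * φ (π b)).re - (star (ψ (π b)) * φ (ρ b)).re) ≤
      ∑ b with β b = j, (‖ψ (π b)‖ ^ 2 + (‖φ (π b)‖ ^ 2 / 2 + ‖φ (ρ b)‖ ^ 2 / 2)) := by
    refine Finset.sum_le_sum fun b _ => ?_
    have h1 := (abs_le.1 (abs_star_mul_re_le (ψ (π b)) (φ (π b)))).2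
    have h2 := (abs_le.1 (abs_star_mul_re_le (ψ (π b)) (φ (ρ b)))).1
    linarith
  rw [Finset.sum_add_distrib, Finset.sum_add_distrib,
    sum_filter_comp_perm j hπ fun b => ‖ψ b‖ ^ 2,
    sum_filter_comp_perm j hπ fun b => ‖φ b‖ ^ 2 / 2,
    sum_filter_comp_perm j hρ fun b => ‖φ b‖ ^ 2 / 2, ← Finset.sum_add_distrib] at e3
  simp only [add_halves] at e3
  simp only [queryWeight]
  linarith

/-- Two unit vectors that are told apart with error at most `1/3` have bounded overlap. -/
theorem overlap_le_of_distinguished (S : Finset ι) (ψ φ : ι → ℂ)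
    (hψ : ∑ b, ‖ψ b‖ ^ 2 = 1) (hφ : ∑ b, ‖φ b‖ ^ 2 = 1)
    (h1 : 2 / 3 ≤ ∑ b ∈ S, ‖ψ b‖ ^ 2) (h2 : ∑ b ∈ S, ‖φ b‖ ^ 2 ≤ 1 / 3) :
    overlap ψ φ ≤ 17 / 18 := by
  classical
  rw [← Finset.sum_add_sum_compl S] at hψ hφ
  have e : overlap ψ φ = ∑ b ∈ S, (star (ψ b) * φ b).re + ∑ b ∈ Sᶜ, (star (ψ b) * φ b).re :=
    (Finset.sum_add_sum_compl S _).symm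
  have hS : ∑ b ∈ S, (star (ψ b) * φ b).re ≤
      (3 / 4 * ∑ b ∈ S, ‖ψ b‖ ^ 2 + 4 / 3 * ∑ b ∈ S, ‖φ b‖ ^ 2) / 2 := by
    rw [Finset.mul_sum, Finset.mul_sum, ← Finset.sum_add_distrib, Finset.sum_div]
    exact Finset.sum_le_sum fun b _ => star_mul_re_le_weighted _ _
  have hS' : ∑ b ∈ Sᶜ, (star (ψ b) * φ b).re ≤
      (3 / 4 * ∑ b ∈ Sᶜ, ‖φ b‖ ^ 2 + 4 / 3 * ∑ b ∈ Sᶜ, ‖ψ b‖ ^ 2) / 2 := by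
    rw [Finset.mul_sum, Finset.mul_sum, ← Finset.sum_add_distrib, Finset.sum_div]
    refine Finset.sum_le_sum fun b _ => ?_
    have h := star_mul_re_le_weighted (φ b) (ψ b)
    have h' : (star (ψ b) * φ b).re = (star (φ b) * ψ b).re := by
      simp [mul_comm]
    rwa [h']
  -- With `a ≥ 2/3` and `b ≤ 1/3` the masses of `ψ` and `φ` on `S`, the bound `3/8 * (a + 1 - b) +
  -- 2/3 * (b + 1 - a)` is largest at the extremes, where it is `1/2 + 4/9 = 17/18`.
  linarith

/-- The adversary bound for deciding whether a subset of a set of `2 * h + 1` elements has `h` or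
`h + 1` elements. -/
theorem succ_le_of_query_algorithm (h T : ℕ) (β : ι → ℕ) (O : Finset ℕ → Equiv.Perm ι)
    (hβ : ∀ x b, β (O x b) = β b)
    (hO : ∀ x j b, β b ≠ j → O x b = O (insert j x) b)
    (ψ : Finset ℕ → ℕ → ι → ℂ) (hinit : ∀ x y, ψ x 0 = ψ y 0)
    (hnorm : ∀ x t, t ≤ T → ∑ b, ‖ψ x t b‖ ^ 2 = 1)
    (hstep : ∀ x y t, t < T → overlap (ψ x (t + 1)) (ψ y (t + 1)) =
      overlap (fun b => ψ x t (O x b)) (fun b => ψ y t (O y b)))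
    (S : Finset ι)
    (hlo : ∀ x ∈ (Finset.range (2 * h + 1)).powersetCard h, 2 / 3 ≤ ∑ b ∈ S, ‖ψ x T b‖ ^ 2)
    (hhi : ∀ x ∈ (Finset.range (2 * h + 1)).powersetCard (h + 1),
      ∑ b ∈ S, ‖ψ x T b‖ ^ 2 ≤ 1 / 3) :
    ((h : ℝ) + 1) / 36 ≤ T := by
  set X := (Finset.range (2 * h + 1)).powersetCard h with hX
  set Y := (Finset.range (2 * h + 1)).powersetCard (h + 1) with hY
  have cardY : Y.card = X.card := by
    rw [hX, hY, Finset.card_powersetCard, Finset.card_powersetCard, Finset.card_range]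
    exact Nat.choose_symm_half h
  have cardpos : (0 : ℝ) < X.card := by
    rw [hX, Finset.card_powersetCard, Finset.card_range]
    exact_mod_cast Nat.choose_pos (by omega)
  have cardsdiff : ∀ x ∈ X, (Finset.range (2 * h + 1) \ x).card = h + 1 := by
    intro x hx
    rw [hX, Finset.mem_powersetCard] at hx
    rw [Finset.card_sdiff_of_subset hx.1, hx.2, Finset.card_range]
    omega
  have insert_mem : ∀ x ∈ X, ∀ j ∈ Finset.range (2 * h + 1) \ x, insert j x ∈ Y := by
    intro x hx j hj
    rw [hX, Finset.mem_powersetCard] at hx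
    rw [Finset.mem_sdiff] at hj
    rw [hY, Finset.mem_powersetCard, Finset.card_insert_of_notMem hj.2, hx.2]
    exact ⟨Finset.insert_subset hj.1 hx.1, rfl⟩
  -- The progress measure: total overlap along the edges of the graph.
  let W : ℕ → ℝ := fun t =>
    ∑ x ∈ X, ∑ j ∈ Finset.range (2 * h + 1) \ x, overlap (ψ x t) (ψ (insert j x) t)
  -- Counting the edges from the upper level, so that the weights of the states for `insert j x` can
  -- also be summed over distinct labels at a fixed vertex.
  have total : ∀ f : Finset ℕ → ℕ → ℝ,
      ∑ x ∈ X, ∑ j ∈ Finset.range (2 * h + 1) \ x, f (insert j x) j =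
        ∑ y ∈ Y, ∑ j ∈ y, f y j := by
    intro f
    rw [Finset.sum_sigma', Finset.sum_sigma']
    refine Finset.sum_bij' (fun p _ => ⟨insert p.2 p.1, p.2⟩) (fun p _ => ⟨p.1.erase p.2, p.2⟩)
      ?_ ?_ ?_ ?_ ?_
    · rintro ⟨x, j⟩ hp
      rw [Finset.mem_sigma] at hp ⊢
      exact ⟨insert_mem x hp.1 j hp.2, Finset.mem_insert_self j x⟩
    · rintro ⟨y, j⟩ hp
      rw [Finset.mem_sigma] at hp ⊢
      obtain ⟨hy, hj⟩ := hp
      dsimp only at hy hj ⊢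
      rw [hY, Finset.mem_powersetCard] at hy
      rw [hX, Finset.mem_powersetCard, Finset.card_erase_of_mem hj, hy.2, Finset.mem_sdiff]
      exact ⟨⟨(Finset.erase_subset j y).trans hy.1, rfl⟩, hy.1 hj, Finset.notMem_erase j y⟩
    · rintro ⟨x, j⟩ hp
      rw [Finset.mem_sigma, Finset.mem_sdiff] at hp
      simp only [Finset.erase_insert hp.2.2]
    · rintro ⟨y, j⟩ hp
      rw [Finset.mem_sigma] at hp
      simp only [Finset.insert_erase hp.2]
    · rintro ⟨x, j⟩ _
      rfl
  have step : ∀ t, t < T → W t ≤ W (t + 1) + 2 * X.card := by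
    intro t ht
    have hle : W t ≤ W (t + 1) +
        ((∑ x ∈ X, ∑ j ∈ Finset.range (2 * h + 1) \ x, queryWeight β j (ψ x t)) +
          ∑ x ∈ X, ∑ j ∈ Finset.range (2 * h + 1) \ x, queryWeight β j (ψ (insert j x) t)) := by
      simp only [W, ← Finset.sum_add_distrib]
      refine Finset.sum_le_sum fun x _ => Finset.sum_le_sum fun j _ => ?_
      rw [hstep x (insert j x) t ht]
      exact overlap_le_overlap_query_add j (hβ x) (hβ _) (hO x j) _ _
    have h1 : ∑ x ∈ X, ∑ j ∈ Finset.range (2 * h + 1) \ x, queryWeight β j (ψ x t) ≤ X.card := by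
      refine (Finset.sum_le_card_nsmul X _ 1 fun x _ => ?_).trans_eq (by simp)
      exact (sum_queryWeight_le β _ _).trans_eq (hnorm x t ht.le)
    have h2 : ∑ x ∈ X, ∑ j ∈ Finset.range (2 * h + 1) \ x, queryWeight β j (ψ (insert j x) t) ≤
        X.card := by
      rw [total fun y j => queryWeight β j (ψ y t), ← cardY]
      refine (Finset.sum_le_card_nsmul Y _ 1 fun x _ => ?_).trans_eq (by simp)
      exact (sum_queryWeight_le β _ _).trans_eq (hnorm x t ht.le)
    linarith
  have steps : ∀ t, t ≤ T → W 0 ≤ W t + t * (2 * X.card) := by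
    intro t
    induction t with
    | zero => simp
    | succ t ih =>
      intro ht
      have := ih (by omega)
      have := step t (by omega)
      push_cast
      linarith
  have start : W 0 = X.card * (h + 1) := by
    have : ∀ x ∈ X, ∑ j ∈ Finset.range (2 * h + 1) \ x, overlap (ψ x 0) (ψ (insert j x) 0) =
        (h : ℝ) + 1 := by
      intro x hx
      rw [Finset.sum_congr rfl fun j _ => by
        rw [hinit (insert j x) x, overlap_self, hnorm x 0 (Nat.zero_le _)]]
      rw [Finset.sum_const, cardsdiff x hx]
      simp
    simp only [W]
    rw [Finset.sum_congr rfl this, Finset.sum_const, nsmul_eq_mul]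
  have final : W T ≤ X.card * ((h + 1) * (17 / 18)) := by
    have : ∀ x ∈ X, ∑ j ∈ Finset.range (2 * h + 1) \ x, overlap (ψ x T) (ψ (insert j x) T) ≤
        ((h : ℝ) + 1) * (17 / 18) := by
      intro x hx
      refine (Finset.sum_le_card_nsmul _ _ (17 / 18) fun j hj => ?_).trans_eq ?_
      · exact overlap_le_of_distinguished S _ _ (hnorm _ T le_rfl) (hnorm _ T le_rfl)
          (hlo x hx) (hhi _ (insert_mem x hx j hj))
      · rw [cardsdiff x hx]
        simp
    exact (Finset.sum_le_card_nsmul _ _ _ this).trans_eq (by simp)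
  have hT := steps T le_rfl
  rw [start] at hT
  have : X.card * (((h : ℝ) + 1) / 36) ≤ X.card * (T : ℝ) := by linarith
  exact le_of_mul_le_mul_left this cardpos

end QueryLowerBound

/-! ### Unary substrings of run-length encoded strings. -/

section Runs

variable {α : Type*}

/-- The string with the given list of runs. -/
def decodeRuns (l : List (α × ℕ)) : List α := l.flatMap fun p => List.replicate p.2 p.1

theorem decodeRuns_append (l₁ l₂ : List (α × ℕ)) :
    decodeRuns (l₁ ++ l₂) = decodeRuns l₁ ++ decodeRuns l₂ := List.flatMap_append

theorem decodeRuns_cons (p : α × ℕ) (l : List (α × ℕ)) :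
    decodeRuns (p :: l) = List.replicate p.2 p.1 ++ decodeRuns l := rfl

theorem decodeRuns_singleton (p : α × ℕ) : decodeRuns [p] = List.replicate p.2 p.1 :=
  List.append_nil _

theorem length_decodeRuns_map_range (f : ℕ → α × ℕ) (n : ℕ) :
    (decodeRuns ((List.range n).map f)).length = ∑ i ∈ Finset.range n, (f i).2 := by
  induction n with
  | zero => rfl
  | succ n ih =>
    rw [List.range_succ, List.map_append, decodeRuns_append, List.length_append, ih,
      Finset.sum_range_succ, List.map_singleton, decodeRuns_singleton, List.length_replicate]

theorem RLEString.decode_eq_decodeRuns {q n : ℕ} (S : RLEString q n) :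
    S.decode = decodeRuns (List.ofFn S.run) := rfl

theorem List.ofFn_val_eq_map_range (f : ℕ → α) (n : ℕ) :
    List.ofFn (fun i : Fin n => f i.val) = (List.range n).map f := by
  refine List.ext_getElem (by simp) fun i h₁ h₂ => by simp

/-- A unary substring is no longer than the longest run. -/
theorem le_of_replicate_infix_decodeRuns {M j : ℕ} {c : α} (l : List (α × ℕ))
    (hchain : l.IsChain fun a b => a.1 ≠ b.1) (hpos : ∀ p ∈ l, 0 < p.2) (hM : ∀ p ∈ l, p.2 ≤ M)
    (h : List.replicate j c <:+: decodeRuns l) : j ≤ M := by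
  induction l with
  | nil =>
    have := h.length_le
    rw [List.length_replicate] at this
    exact this.trans (Nat.zero_le M)
  | cons p l ih =>
    have ih' := ih hchain.tail (fun a ha => hpos a (List.mem_cons_of_mem p ha))
      (fun a ha => hM a (List.mem_cons_of_mem p ha))
    have hp := hM p List.mem_cons_self
    rw [decodeRuns_cons, List.infix_append_iff] at h
    rcases h with h | h | ⟨l₁, l₂, he, h₁, h₂⟩
    · have := h.length_le
      simp only [List.length_replicate] at this
      omega
    · exact ih' h
    -- An occurrence with letters on both sides of the boundary would give two neighbouring runs the
    -- same character, as the next run is nonempty.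
    · have hlen := congrArg List.length he
      rw [List.length_replicate, List.length_append] at hlen
      have hl₁ := h₁.length_le
      rw [List.length_replicate] at hl₁
      rcases l₁ with _ | ⟨a, l₁⟩
      · rw [List.nil_append] at he
        rw [← he] at h₂
        exact ih' h₂.isInfix
      rcases l₂ with _ | ⟨b, l₂⟩
      · simp only [List.length_nil] at hlen
        omega
      have ha : a = c := List.eq_of_mem_replicate (he ▸ by simp : a ∈ List.replicate j c)
      have hb : b = c := List.eq_of_mem_replicate (he ▸ by simp : b ∈ List.replicate j c)
      have ha' : a = p.1 := List.eq_of_mem_replicate (h₁.subset List.mem_cons_self)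
      rcases l with _ | ⟨p', l⟩
      · exact absurd h₂.length_le (by simp [decodeRuns])
      · rw [List.isChain_cons_cons] at hchain
        have hp' := hpos p' (by simp)
        obtain ⟨m, hm⟩ : ∃ m, p'.2 = m + 1 := ⟨p'.2 - 1, by omega⟩
        rw [decodeRuns_cons, hm, List.replicate_succ, List.cons_append,
          List.cons_prefix_cons] at h₂
        exact absurd (by rw [← ha', ha, ← h₂.1, hb]) hchain.1

/-- A long common substring of `D ++ z ^ k` and `z ^ k ++ E` is unary. -/
theorem eq_replicate_of_infix {D E t : List α} {z : α} {k m M : ℕ}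
    (hD : D.length ≤ m) (hE : E.length ≤ m) (hlast : ∀ h : D ≠ [], D.getLast h ≠ z)
    (hrun : ∀ j, List.replicate j z <:+: D → j ≤ M) (ht : m + M < t.length)
    (h₁ : t <:+: D ++ List.replicate k z) (h₂ : t <:+: List.replicate k z ++ E) :
    t = List.replicate t.length z := by
  have unary : ∀ s : List α, s <:+: List.replicate k z → s = List.replicate s.length z :=
    fun s hs => List.eq_replicate_of_mem fun b hb => List.eq_of_mem_replicate (hs.subset hb)
  rw [List.infix_append_iff] at h₁ h₂
  rcases h₁ with h₁ | h₁ | ⟨s, p, rfl, hs, hp⟩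
  · have := h₁.length_le
    omega
  · exact unary t h₁
  rcases h₂ with h₂ | h₂ | ⟨p', v, he, hp', hv⟩
  · exact unary _ h₂
  · have := h₂.length_le
    omega
  have hlen : M < p'.length := by
    have h1 := congrArg List.length he
    have h2 := hv.length_le
    rw [List.length_append (as := p')] at h1
    omega
  have hp'z := unary p' hp'.isInfix
  rcases eq_or_ne s [] with rfl | hs0
  · rw [List.nil_append]
    exact unary p hp.isInfix
  exfalso
  have hnotall : ¬ ∀ b ∈ s, b = z := by
    intro hall
    have hD0 : D ≠ [] := by
      rintro rfl
      exact hs0 (List.suffix_nil.1 hs)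
    obtain ⟨u, rfl⟩ := hs
    apply hlast hD0
    rw [List.getLast_append_of_ne_nil _ hs0]
    exact hall _ (List.getLast_mem hs0)
  -- Now `t = s ++ p = p' ++ v`, where `s` is a suffix of `D` containing a letter other than `z`,
  -- and `p'` consists of more than `M` letters `z`. Either `s` lies inside `p'`, or `p'` is too
  -- long a power of `z` inside `D`.
  rcases List.append_eq_append_iff.1 he with ⟨a, ha, -⟩ | ⟨a, ha, -⟩
  · refine hnotall fun b hb => List.eq_of_mem_replicate (n := p'.length) ?_
    rw [← hp'z, ha]
    exact List.mem_append_left a hb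
  · have hpre : p' <+: s := ⟨a, ha.symm⟩
    have := hrun p'.length (hp'z ▸ hpre.isInfix.trans hs.isInfix)
    omega

theorem RLEString.decode_eq_replicate_of_one {q : ℕ} (S : RLEString q 1) :
    ∃ c, S.decode = List.replicate S.decode.length c := by
  refine ⟨(S.run 0).1, ?_⟩
  simp [RLEString.decode]

theorem RLEString.eq_one_of_decode_eq_replicate {q n : ℕ} (S : RLEString q n) {c : Fin q}
    (hne : S.decode ≠ []) (h : S.decode = List.replicate S.decode.length c) : n = 1 := by
  have key : ∀ i, (S.run i).1 = c := by
    intro i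
    refine List.eq_of_mem_replicate (n := S.decode.length) ?_
    rw [← h, RLEString.decode, List.mem_flatMap]
    refine ⟨S.run i, List.mem_ofFn.2 ⟨i, rfl⟩, ?_⟩
    rw [List.mem_replicate]
    exact ⟨(S.run_pos i).ne', rfl⟩
  rcases n with _ | _ | n
  · exact absurd (by simp [RLEString.decode]) hne
  · rfl
  · exact absurd ((key ⟨0, by omega⟩).trans (key ⟨1, by omega⟩).symm)
      (S.run_maximal _ _ rfl)

theorem RLEString.le_of_replicate_infix {q n M j : ℕ} (S : RLEString q n) {c : Fin q}
    (hM : ∀ i, (S.run i).2 ≤ M) (h : List.replicate j c <:+: S.decode) : j ≤ M := by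
  refine le_of_replicate_infix_decodeRuns (List.ofFn S.run) ?_ ?_ ?_ h
  · rw [List.isChain_ofFn]
    exact fun i hi => S.run_maximal _ _ rfl
  · intro p hp
    obtain ⟨i, rfl⟩ := List.mem_ofFn.1 hp
    exact S.run_pos i
  · intro p hp
    obtain ⟨i, rfl⟩ := List.mem_ofFn.1 hp
    exact hM i

end Runs

/-! ### The hard inputs and their longest common substrings. -/

section HardInputs

variable {q : ℕ}

/-- The binary alphabet inside `Fin q`, indexed by parity: `1` at even numbers, `0` at odd ones. -/
def parityChar (hq : 2 ≤ q) (i : ℕ) : Fin q := if i % 2 = 0 then ⟨1, hq⟩ else ⟨0, by omega⟩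

theorem parityChar_congr (hq : 2 ≤ q) {i j : ℕ} (h : i % 2 = j % 2) :
    parityChar hq i = parityChar hq j := by
  rw [parityChar, parityChar, h]

theorem parityChar_ne (hq : 2 ≤ q) {i j : ℕ} (h : i % 2 ≠ j % 2) :
    parityChar hq i ≠ parityChar hq j := by
  have hne : (⟨1, hq⟩ : Fin q) ≠ ⟨0, by omega⟩ := by simp
  rw [parityChar, parityChar]
  split_ifs
  · omega
  · exact hne
  · exact hne.symm
  · omega

/-- The length of the `j`-th payload run for the bit string with support `x`; each bit determines
six consecutive runs. -/
def bitRunLength (x : Finset ℕ) (j : ℕ) : ℕ := if j / 6 ∈ x then 2 else 1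

theorem bitRunLength_pos (x : Finset ℕ) (j : ℕ) : 0 < bitRunLength x j := by
  rw [bitRunLength]
  split_ifs <;> omega

theorem bitRunLength_le (x : Finset ℕ) (j : ℕ) : bitRunLength x j ≤ 2 := by
  rw [bitRunLength]
  split_ifs <;> omega

theorem bitRunLength_insert {x : Finset ℕ} {i j : ℕ} (h : j / 6 ≠ i) :
    bitRunLength (insert i x) j = bitRunLength x j := by
  simp [bitRunLength, h]

theorem sum_bitRunLength {x : Finset ℕ} {m p : ℕ} (hx : x ⊆ Finset.range m) (hm : 6 * m ≤ p) :
    ∑ j ∈ Finset.range p, bitRunLength x j = p + 6 * x.card := by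
  have h1 : ∀ j, bitRunLength x j = 1 + if j / 6 ∈ x then 1 else 0 := by
    intro j
    rw [bitRunLength]
    split_ifs <;> rfl
  have h2 : (Finset.range p).filter (fun j => j / 6 ∈ x) =
      (x ×ˢ Finset.range 6).image fun a => 6 * a.1 + a.2 := by
    ext j
    simp only [Finset.mem_filter, Finset.mem_range, Finset.mem_image, Finset.mem_product,
      Prod.exists]
    constructor
    · rintro ⟨-, hj⟩
      exact ⟨j / 6, j % 6, ⟨hj, by omega⟩, by omega⟩
    · rintro ⟨a, b, ⟨ha, hb⟩, rfl⟩
      have := Finset.mem_range.1 (hx ha)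
      have e : (6 * a + b) / 6 = a := by omega
      exact ⟨by omega, by rwa [e]⟩
  have h3 : Set.InjOn (fun a : ℕ × ℕ => 6 * a.1 + a.2) (x ×ˢ Finset.range 6 : Finset (ℕ × ℕ)) := by
    rintro ⟨a, b⟩ hab ⟨c, d⟩ hcd e
    simp only [Finset.coe_product, Set.mem_prod, Finset.mem_coe, Finset.mem_range] at hab hcd e
    exact Prod.ext (by dsimp only; omega) (by dsimp only; omega)
  rw [Finset.sum_congr rfl fun j _ => h1 j, Finset.sum_add_distrib, Finset.sum_boole, h2,
    Nat.cast_id, Finset.card_image_of_injOn h3, Finset.card_product]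
  simp [mul_comm]

/-- The payload for `x`, preceded by `r` short runs and followed by a run of `k` zeros. -/
def payloadThenZeros (hq : 2 ≤ q) {k : ℕ} (hk : 0 < k) (p r : ℕ) (x : Finset ℕ) :
    RLEString q (p + r + 1) where
  -- The shift by `r` lets the payload start with the character 1 for every `r`. For `i < r` the
  -- truncated subtraction gives 0, so the padding copies the length of payload run 0.
  run i := (parityChar hq (i.val + r), if i.val = p + r then k else bitRunLength x (i.val - r))
  run_pos i := by
    dsimp only
    split_ifs
    · exact hk
    · exact bitRunLength_pos _ _
  run_maximal i j h := parityChar_ne hq (by omega)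

/-- A run of `k` zeros followed by the payload for `x` and by `r` short runs. -/
def zerosThenPayload (hq : 2 ≤ q) {k : ℕ} (hk : 0 < k) (p r : ℕ) (x : Finset ℕ) :
    RLEString q (p + r + 1) where
  run i := (parityChar hq (i.val + 1), if i.val = 0 then k else bitRunLength x (i.val - 1))
  run_pos i := by
    dsimp only
    split_ifs
    · exact hk
    · exact bitRunLength_pos _ _
  run_maximal i j h := parityChar_ne hq (by omega)

/-- The runs that both strings have in common. -/
def payloadRuns (hq : 2 ≤ q) (p : ℕ) (x : Finset ℕ) : List (Fin q × ℕ) :=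
  (List.range p).map fun i => (parityChar hq i, bitRunLength x i)

/-- The payload runs preceded by `r` short runs. -/
def prependedRuns (hq : 2 ≤ q) (p r : ℕ) (x : Finset ℕ) : List (Fin q × ℕ) :=
  (List.range (p + r)).map fun i => (parityChar hq (i + r), bitRunLength x (i - r))

theorem length_decodeRuns_payloadRuns (hq : 2 ≤ q) {m p : ℕ} {x : Finset ℕ}
    (hx : x ⊆ Finset.range m) (hm : 6 * m ≤ p) :
    (decodeRuns (payloadRuns hq p x)).length = p + 6 * x.card := by
  rw [payloadRuns, length_decodeRuns_map_range, sum_bitRunLength hx hm]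

theorem sum_bitRunLength_le (x : Finset ℕ) (f : ℕ → ℕ) (r : ℕ) :
    ∑ i ∈ Finset.range r, bitRunLength x (f i) ≤ 2 * r := by
  refine (Finset.sum_le_card_nsmul _ _ 2 fun i _ => bitRunLength_le x _).trans_eq ?_
  rw [Finset.card_range, smul_eq_mul, mul_comm]

theorem exists_decode_prependedRuns (hq : 2 ≤ q) (p r : ℕ) (x : Finset ℕ) :
    ∃ u : List (Fin q), u.length ≤ 2 * r ∧
      decodeRuns (prependedRuns hq p r x) = u ++ decodeRuns (payloadRuns hq p x) := by
  refine ⟨decodeRuns ((List.range r).map fun i => (parityChar hq (i + r), bitRunLength x (i - r))),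
    ?_, ?_⟩
  · rw [length_decodeRuns_map_range]
    exact sum_bitRunLength_le x _ r
  · rw [← decodeRuns_append, prependedRuns, add_comm p r, List.range_add, List.map_append,
      List.map_map, payloadRuns]
    congr 2
    refine List.map_congr_left fun i _ => Prod.ext ?_ ?_
    · exact parityChar_congr hq (by dsimp only; omega)
    · simp

theorem decode_payloadThenZeros (hq : 2 ≤ q) {k : ℕ} (hk : 0 < k) {p : ℕ} (hp : p % 2 = 1) (r : ℕ)
    (x : Finset ℕ) : (payloadThenZeros hq hk p r x).decode =
      decodeRuns (prependedRuns hq p r x) ++ List.replicate k (parityChar hq 1) := by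
  have e : List.ofFn (payloadThenZeros hq hk p r x).run = (List.range (p + r + 1)).map
      fun i => (parityChar hq (i + r), if i = p + r then k else bitRunLength x (i - r)) :=
    List.ofFn_val_eq_map_range
      (fun i => (parityChar hq (i + r), if i = p + r then k else bitRunLength x (i - r))) _
  rw [RLEString.decode_eq_decodeRuns, e, List.range_succ, List.map_append, decodeRuns_append,
    List.map_singleton, decodeRuns_singleton, if_pos rfl, prependedRuns]
  refine congrArg₂ _ (congrArg _ (List.map_congr_left fun i hi => ?_)) ?_
  · rw [if_neg (List.mem_range.1 hi).ne]
  · exact congrArg _ (parityChar_congr hq (by omega))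

theorem exists_decode_zerosThenPayload (hq : 2 ≤ q) {k : ℕ} (hk : 0 < k) (p r : ℕ)
    (x : Finset ℕ) : ∃ v : List (Fin q), v.length ≤ 2 * r ∧
      (zerosThenPayload hq hk p r x).decode =
        List.replicate k (parityChar hq 1) ++ (decodeRuns (payloadRuns hq p x) ++ v) := by
  refine ⟨decodeRuns ((List.range r).map
    fun i => (parityChar hq (p + i), bitRunLength x (p + i))), ?_, ?_⟩
  · rw [length_decodeRuns_map_range]
    exact sum_bitRunLength_le x _ r
  have e : List.ofFn (zerosThenPayload hq hk p r x).run = (List.range (p + r + 1)).map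
      fun i => (parityChar hq (i + 1), if i = 0 then k else bitRunLength x (i - 1)) :=
    List.ofFn_val_eq_map_range
      (fun i => (parityChar hq (i + 1), if i = 0 then k else bitRunLength x (i - 1))) _
  rw [RLEString.decode_eq_decodeRuns, e, List.range_succ_eq_map, List.map_cons, decodeRuns_cons,
    if_pos rfl, ← decodeRuns_append, List.range_add, List.map_append, List.map_append,
    List.map_map, List.map_map, List.map_map, payloadRuns]
  refine congrArg₂ _ rfl (congrArg _ (congrArg₂ _ ?_ ?_))
  · refine List.map_congr_left fun i _ => Prod.ext (parityChar_congr hq (by omega)) ?_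
    simp
  · refine List.map_congr_left fun i _ => Prod.ext (parityChar_congr hq (by dsimp only; omega)) ?_
    simp

/-- Since `p` is odd, the last payload run has even index, hence character 1. The final zeros are
therefore not extended by the payload. -/
theorem getLast_decodeRuns_prependedRuns_ne (hq : 2 ≤ q) {p : ℕ} (hp : p % 2 = 1) (r : ℕ)
    (x : Finset ℕ) (h : decodeRuns (prependedRuns hq p r x) ≠ []) :
    (decodeRuns (prependedRuns hq p r x)).getLast h ≠ parityChar hq 1 := by
  obtain ⟨u, hu⟩ : ∃ u, p + r = u + 1 := ⟨p + r - 1, by omega⟩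
  have hne : List.replicate (bitRunLength x (u - r)) (parityChar hq (u + r)) ≠ [] := by
    rw [Ne, List.replicate_eq_nil_iff]
    exact (bitRunLength_pos x _).ne'
  have e : decodeRuns (prependedRuns hq p r x) =
      decodeRuns ((List.range u).map fun i => (parityChar hq (i + r), bitRunLength x (i - r))) ++
        List.replicate (bitRunLength x (u - r)) (parityChar hq (u + r)) := by
    rw [prependedRuns, hu, List.range_succ, List.map_append, decodeRuns_append,
      List.map_singleton, decodeRuns_singleton]
  simp only [e]
  rw [List.getLast_append_of_ne_nil _ hne, List.eq_of_mem_replicate (List.getLast_mem hne)]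
  exact parityChar_ne hq (by omega)

theorem le_two_of_replicate_infix_prependedRuns (hq : 2 ≤ q) (p r : ℕ) (x : Finset ℕ) {j : ℕ}
    {c : Fin q} (h : List.replicate j c <:+: decodeRuns (prependedRuns hq p r x)) : j ≤ 2 := by
  refine le_of_replicate_infix_decodeRuns _ ?_ ?_ ?_ h
  · rw [prependedRuns, List.isChain_map, List.isChain_range]
    exact fun i _ => parityChar_ne hq (by simp only [Nat.succ_eq_add_one]; omega)
  · intro a ha
    obtain ⟨i, -, rfl⟩ := List.mem_map.1 ha
    exact bitRunLength_pos _ _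
  · intro a ha
    obtain ⟨i, -, rfl⟩ := List.mem_map.1 ha
    exact bitRunLength_le _ _

/-- If the zeros are longer than the payload, every longest common substring is a single run. -/
theorem IsLCSRLEAnswer.runs_eq_one (hq : 2 ≤ q) {k : ℕ} (hk : 0 < k) {p : ℕ} (hp : p % 2 = 1)
    (r : ℕ) (x : Finset ℕ)
    (hlen : (decodeRuns (payloadRuns hq p x)).length + 2 * r + 2 < k) {out : ℕ × ℕ × ℕ}
    (h : IsLCSRLEAnswer (payloadThenZeros hq hk p r x) (zerosThenPayload hq hk p r x) out) :
    out.2.2 = 1 := by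
  obtain ⟨s, ⟨hA, hB, hmax⟩, -, -⟩ := h
  obtain ⟨u, hu, hu'⟩ := exists_decode_prependedRuns hq p r x
  obtain ⟨v, hv, hv'⟩ := exists_decode_zerosThenPayload hq hk p r x
  rw [decode_payloadThenZeros hq hk hp] at hA hmax
  rw [hv'] at hB hmax
  have hlong := hmax (List.replicate k (parityChar hq 1)) List.infix_append_right
    List.infix_append_left
  rw [List.length_replicate] at hlong
  have heq := eq_replicate_of_infix
    (m := (decodeRuns (payloadRuns hq p x)).length + 2 * r) (M := 2)
    (by rw [hu', List.length_append]; omega) (by rw [List.length_append]; omega)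
    (getLast_decodeRuns_prependedRuns_ne hq hp r x)
    (fun j hj => le_two_of_replicate_infix_prependedRuns hq p r x hj) (by omega) hA hB
  exact s.eq_one_of_decode_eq_replicate (List.ne_nil_of_length_pos (by omega)) heq

/-- If the payload is longer than the zeros, no longest common substring is a single run. -/
theorem IsLCSRLEAnswer.runs_ne_one (hq : 2 ≤ q) {k : ℕ} (hk : 2 ≤ k) {p : ℕ} (hp : p % 2 = 1)
    (r : ℕ) (x : Finset ℕ) (hlen : k < (decodeRuns (payloadRuns hq p x)).length)
    {out : ℕ × ℕ × ℕ}
    (h : IsLCSRLEAnswer (payloadThenZeros hq (two_pos.trans_le hk) p r x)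
      (zerosThenPayload hq (two_pos.trans_le hk) p r x) out) :
    out.2.2 ≠ 1 := by
  obtain ⟨i, j, l⟩ := out
  rintro hl
  dsimp only at hl
  subst hl
  obtain ⟨s, ⟨hA, hB, hmax⟩, -, -⟩ := h
  dsimp only at s hA hB hmax
  obtain ⟨c, hc⟩ := s.decode_eq_replicate_of_one
  rw [hc] at hA
  have hle := RLEString.le_of_replicate_infix (M := k) (payloadThenZeros hq _ p r x)
    (fun i => by
      simp only [payloadThenZeros]
      split_ifs
      · exact le_rfl
      · exact (bitRunLength_le x _).trans hk) hA
  obtain ⟨u, hu, hu'⟩ := exists_decode_prependedRuns hq p r x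
  obtain ⟨v, hv, hv'⟩ := exists_decode_zerosThenPayload hq (two_pos.trans_le hk) p r x
  rw [decode_payloadThenZeros hq _ hp, hv', hu'] at hmax
  have := hmax (decodeRuns (payloadRuns hq p x)) (List.infix_append _ _ _)
    (List.infix_append' _ _ _)
  omega

end HardInputs

/-! ### Reduction from weight discrimination to LCS. -/

namespace QuantumQueryAlgorithm

theorem stateAfter_succ {q n N w T : ℕ} (𝒜 : QuantumQueryAlgorithm q n N w T)
    (A B : RLEString q n) {t : ℕ} (ht : t < T) :
    𝒜.stateAfter A B (t + 1) = Matrix.mulVec (𝒜.unitary ⟨t + 1, Nat.succ_lt_succ ht⟩).val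
      (fun x => 𝒜.stateAfter A B t ((oraclePerm N w A B).symm x)) := by
  rw [stateAfter, dif_pos (Nat.succ_lt_succ ht)]

theorem sum_norm_sq_stateAfter {q n N w T : ℕ} (𝒜 : QuantumQueryAlgorithm q n N w T)
    (A B : RLEString q n) {t : ℕ} (ht : t ≤ T) : ∑ b, ‖𝒜.stateAfter A B t b‖ ^ 2 = 1 := by
  rw [← overlap_self]
  induction t with
  | zero =>
    rw [stateAfter, overlap_mulVec, overlap_self]
    rw [Finset.sum_eq_single_of_mem 𝒜.init (Finset.mem_univ _)]
    · simp
    · intro b _ hb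
      simp [hb]
  | succ t ih =>
    rw [stateAfter_succ 𝒜 A B ht, overlap_mulVec, overlap_comp_perm]
    exact ih (by omega)

/-- The value of `k` fits strictly between `p + 6 * h + 2 * r + 2`, needed for the zeros to win, and
`p + 6 * (h + 1)`, the heavier payload. As `2 * r + 2` can be 4, six runs per bit is the least
number leaving room. -/
theorem succ_le_of_solves {p r h k q N w T : ℕ} (hq : 2 ≤ q) (hp : p % 2 = 1) (hr : r ≤ 1)
    (hh : 6 * (2 * h + 1) ≤ p) (hk : k = p + 6 * h + 5) (hN : 8 * (p + r + 1) ≤ N)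
    (𝒜 : QuantumQueryAlgorithm q (p + r + 1) N w T) (h𝒜 : 𝒜.SolvesLCSRLE) :
    ((h : ℝ) + 1) / 36 ≤ T := by
  classical
  have hk2 : 2 ≤ k := by omega
  let A := payloadThenZeros hq (two_pos.trans_le hk2) p r
  let B := zerosThenPayload hq (two_pos.trans_le hk2) p r
  have success : ∀ x, x ⊆ Finset.range (2 * h + 1) → x.card ≤ h + 1 →
      2 / 3 ≤ 𝒜.successProb (A x) (B x) := by
    intro x hx hcard
    have hz := length_decodeRuns_payloadRuns hq hx hh
    obtain ⟨u, hu, hu'⟩ := exists_decode_prependedRuns hq p r x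
    obtain ⟨v, hv, hv'⟩ := exists_decode_zerosThenPayload hq (two_pos.trans_le hk2) p r x
    refine h𝒜 _ _ ?_ ?_
    · simp only [A]
      rw [decode_payloadThenZeros hq _ hp, hu', List.length_append, List.length_append,
        List.length_replicate]
      omega
    · simp only [B]
      rw [hv', List.length_append, List.length_append, List.length_replicate]
      omega
  let S : Finset (BasisLabel q (p + r + 1) N w) :=
    Finset.univ.filter fun b => (𝒜.output b).2.2 = 1
  refine succ_le_of_query_algorithm h T (ι := BasisLabel q (p + r + 1) N w)
    -- The label is the bit that the queried run may depend on. The run of zeros also receives a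
    -- label, which is harmless because its length is constant.
    (fun b => cond b.1 (b.2.1.val - 1) (b.2.1.val - r) / 6)
    (fun x => (oraclePerm N w (A x) (B x)).symm) (fun x b => rfl) ?_
    (fun x t => 𝒜.stateAfter (A x) (B x) t) (fun x y => rfl)
    (fun x t ht => 𝒜.sum_norm_sq_stateAfter _ _ ht) ?_ S ?_ ?_
  · rintro x j ⟨s, i, c, l, z⟩ hb
    have hrun : (cond s (B x) (A x)).run i = (cond s (B (insert j x)) (A (insert j x))).run i := by
      cases s
      · simp only [cond_false, A, payloadThenZeros] at hb ⊢
        rw [bitRunLength_insert hb]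
      · simp only [cond_true, B, zerosThenPayload] at hb ⊢
        rw [bitRunLength_insert hb]
    -- The oracle is an involution, so its inverse is the same map.
    change oracleMap N w (A x) (B x) (s, i, c, l, z) =
      oracleMap N w (A (insert j x)) (B (insert j x)) (s, i, c, l, z)
    simp only [oracleMap, hrun]
  · intro x y t ht
    rw [stateAfter_succ _ _ _ ht, stateAfter_succ _ _ _ ht, overlap_mulVec]
  · intro x hx
    rw [Finset.mem_powersetCard] at hx
    refine (success x hx.1 (by omega)).trans ?_
    refine Finset.sum_le_sum_of_subset_of_nonneg (fun b hb => ?_) fun _ _ _ => sq_nonneg _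
    rw [Finset.mem_filter] at hb ⊢
    refine ⟨hb.1, IsLCSRLEAnswer.runs_eq_one hq _ hp r x ?_ hb.2⟩
    rw [length_decodeRuns_payloadRuns hq hx.1 hh]
    omega
  · intro x hx
    rw [Finset.mem_powersetCard] at hx
    have h1 : 2 / 3 ≤ ∑ b ∈ Sᶜ, ‖𝒜.stateAfter (A x) (B x) T b‖ ^ 2 := by
      refine (success x hx.1 (by omega)).trans ?_
      refine Finset.sum_le_sum_of_subset_of_nonneg (fun b hb => ?_) fun _ _ _ => sq_nonneg _
      rw [Finset.mem_filter] at hb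
      rw [Finset.mem_compl, Finset.mem_filter, not_and]
      refine fun _ => IsLCSRLEAnswer.runs_ne_one hq hk2 hp r x ?_ hb.2
      rw [length_decodeRuns_payloadRuns hq hx.1 hh]
      omega
    have h2 := 𝒜.sum_norm_sq_stateAfter (A x) (B x) le_rfl
    rw [← Finset.sum_add_sum_compl S] at h2
    linarith

end QuantumQueryAlgorithm

theorem mainTheorem5 :
    ∃ c : ℝ, 0 < c ∧ ∃ n₀ : ℕ, ∀ n N q w T : ℕ, n₀ ≤ n → 8 * n ≤ N → 2 ≤ q →
      ∀ 𝒜 : QuantumQueryAlgorithm q n N w T, 𝒜.SolvesLCSRLE →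
        c * (n : ℝ) / Real.log (n : ℝ) ^ 2 ≤ (T : ℝ) := by
  -- Here `864 = 24 * 36`, from `n ≤ 24 * (h + 1)` and `(h + 1) / 36 ≤ T`. The logarithm, at least
  -- 1, only weakens the bound.
  refine ⟨1 / 864, by norm_num, 20, fun n N q w T hn hN hq 𝒜 h𝒜 => ?_⟩
  have hlog : 1 ≤ Real.log n := by
    rw [Real.le_log_iff_exp_le (by positivity)]
    have : (20 : ℝ) ≤ n := by exact_mod_cast hn
    linarith [Real.exp_one_lt_d9]
  have hlin : 1 / 864 * (n : ℝ) / Real.log n ^ 2 ≤ 1 / 864 * (n : ℝ) :=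
    div_le_self (by positivity) (one_le_pow₀ hlog)
  refine hlin.trans ?_
  -- The padding `r` absorbs the parity of `n`, since `p` has to be odd.
  obtain ⟨p, r, hr, hp, rfl⟩ : ∃ p r, r ≤ 1 ∧ p % 2 = 1 ∧ n = p + r + 1 :=
    ⟨n - 1 - n % 2, n % 2, by omega, by omega, by omega⟩
  have hT := 𝒜.succ_le_of_solves (h := (p + r + 1 - 8) / 12) hq hp hr (by omega) rfl hN h𝒜
  have hh : p + r + 1 ≤ 24 * ((p + r + 1 - 8) / 12 + 1) := by omega
  have hh' : ((p + r + 1 : ℕ) : ℝ) ≤ 24 * (((p + r + 1 - 8) / 12 : ℕ) + 1) := by exact_mod_cast hh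
  linarith
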